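/- Finite-sample replacement of the true parameter in the Fisher information ratio. Setting. Let $X_p$ be a finite nonempty pool of covariates, let $1<c<\infty$ be the number of classes, let $\Omega\subset\mathbb R^d$ be compact, and let $\theta_0\in\Omega$ be such that some open ball around $\theta_0$ is contained in $\Omega$. Let $p(y\mid x,\theta)>0$ ($x\in X_p$, $y\in\{1,\dots,c\}$) be conditional class probabilities, $\sum_y p(y\mid x,\theta)=1$ for $\theta\in\Omega$, whose logarithm $\ell(\theta;x,y)=\log p(y\mid x,\theta)$ is $C^3$ at every point of $\Omega$ as a function of $\theta$. For a probability mass function $r$ on $X_p$ let $P_{r,\theta}$ be the joint law of $(x,y)$ with mass $r(x)\,p(y\mid x,\theta)$ and let $$I(\theta,x)=\sum_{y=1}^c p(y\mid x,\theta)\,\nabla_\theta\ell(\theta;x,y)\,\nabla_\theta\ell(\theta;x,y)^{\top},\qquad I_r(\theta)=\sum_{x\in X_p} r(x)\,I(\theta,x)$$ be the conditional Fisher information and the Fisher information. Let the test marginal $p$ be the uniform distribution on $X_p$, and let $r$ be the marginal from which the current training covariates are drawn. Assumptions. (a) For each of the two marginals $s\in\{r,p\}$: the laws $P_{s,\theta}$,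 $\theta\in\Omega$, are pairwise distinct and have a common support, and $I_s(\theta)$ is positive definite for every $\theta\in\Omega$. (b) The Hessian $\nabla^2_\theta\ell(\theta;x,y)$ does not depend on $y$, for all $\theta\in\Omega$ and $x\in X_p$. (c) There are constants $L_1,L_2,L_3,L_4\ge 0$ such that for all $x\in X_p$, all $y$, all $\theta\in\Omega$, and all $\theta',\theta''$ in a fixed neighbourhood of $\theta_0$ (with $\|\cdot\|$ the spectral norm and $\preceq$ the Loewner order) $$\nabla\ell(\theta_0;x,y)^\top I_p(\theta_0)^{-1}\nabla\ell(\theta_0;x,y)\le L_1,\qquad \big\|I_p(\theta_0)^{-1/2}I(\theta_0,x)I_p(\theta_0)^{-1/2}\big\|\le L_2,$$ $$\big\|I_p(\theta_0)^{-1/2}\big(I(\theta',x)-I(\theta'',x)\big)I_p(\theta_0)^{-1/2}\big\|\le L_3\sqrt{(\theta'-\theta'')^\top I_p(\theta_0)(\theta'-\theta'')},$$ $$-L_4\|\theta-\theta_0\|_2\,I(\theta_0,x)\preceq I(\theta,x)-I(\theta_0,x)\preceq L_4\|\theta-\theta_0\|_2\,I(\theta_0,x).$$ Conclusion. There is a constant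 $C>0$, depending on the above data but not on $\beta$, $\delta$ or $n'$, such that for every $\beta\ge 10$, every $\delta\in(0,1)$ and every integer $n'\ge C\beta^2/\delta$ the following holds. Let $(x_1,y_1),\dots,(x_{n'},y_{n'})$ be independent with law $P_{r,\theta_0}$, and let $\hat\theta_{n'}$ be any maximum likelihood estimator, that is, any maximizer over $\Omega$ of $\theta\mapsto\sum_{i=1}^{n'}\ell(\theta;x_i,y_i)$. Then with probability at least $1-\delta$, $$\operatorname{tr}\big[I_q(\theta_0)^{-1}I_p(\theta_0)\big]\;\le\;\frac{\beta+1}{\beta-1}\,\operatorname{tr}\big[I_q(\hat\theta_{n'})^{-1}I_p(\hat\theta_{n'})\big]$$ simultaneously for all proposal marginals $q$ on $X_p$ such that $I_q(\theta)$ is positive definite for every $\theta\in\Omega$ (in particular for $q=r$). -/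

import Mathlib

open MeasureTheory Filter Topology
open scoped Matrix

noncomputable section

namespace FIR

/-- Parameter vectors, with the Euclidean norm. -/
abbrev Param (d : ℕ) := EuclideanSpace ℝ (Fin d)

variable {X : Type*} [Fintype X] {c d : ℕ}

/-- `ℓ(θ; x, y) = log p(y | x, θ)`, as a function of `θ`; the conditional class probability
`p(y | x, θ)` is `m x y θ`. -/
def logLik (m : X → Fin c → Param d → ℝ) (x : X) (y : Fin c) (θ : Param d) : ℝ :=
  Real.log (m x y θ)

/-- The score `∇_θ ℓ(θ; x, y)`. -/
def score (m : X → Fin c → Param d → ℝ) (θ : Param d) (x : X) (y : Fin c) : Param d :=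
  gradient (logLik m x y) θ

/-- The Hessian `∇²_θ ℓ(θ; x, y)`, as a bilinear form. -/
def hessian (m : X → Fin c → Param d → ℝ) (θ : Param d) (x : X) (y : Fin c) :
    Param d →L[ℝ] Param d →L[ℝ] ℝ :=
  fderiv ℝ (fderiv ℝ (logLik m x y)) θ

/-- The joint law on pairs `(x, y)` with mass `r(x) p(y | x, θ)`. -/
def jointLaw [MeasurableSpace X] (m : X → Fin c → Param d → ℝ) (r : X → ℝ) (θ : Param d) :
    Measure (X × Fin c) :=
  ∑ x, ∑ y, ENNReal.ofReal (r x * m x y θ) • Measure.dirac (x, y)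

/-- The conditional Fisher information
`I(θ, x) = E_{y ∼ p(· | x, θ)} [∇ℓ(θ; x, y) ∇ℓ(θ; x, y)ᵀ]`. -/
def condFisher (m : X → Fin c → Param d → ℝ) (θ : Param d) (x : X) :
    Matrix (Fin d) (Fin d) ℝ :=
  ∑ y, m x y θ • Matrix.vecMulVec (score m θ x y).ofLp (score m θ x y).ofLp

/-- The Fisher information `I_r(θ)` of the joint law with marginal `r`: the expectation of
`∇ℓ(θ; x, y) ∇ℓ(θ; x, y)ᵀ` when `(x, y)` has mass `r(x) p(y | x, θ)`. -/
def fisher (m : X → Fin c → Param d → ℝ) (r : X → ℝ) (θ : Param d) :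
    Matrix (Fin d) (Fin d) ℝ :=
  ∑ x, r x • condFisher m θ x

/-- The uniform distribution over the pool `X`. -/
def uniformMarginal (X : Type*) [Fintype X] : X → ℝ := fun _ => (Fintype.card X : ℝ)⁻¹

/-- The assumptions on the conditional model, the parameter space and the true parameter:
`m x y θ` is a (positive, so that its logarithm is finite) conditional probability mass for
`θ ∈ Ω`, with a `C³` logarithm; `Ω` is compact and contains a ball around `θ₀`. -/
structure ModelAssumptions (m : X → Fin c → Param d → ℝ) (Ω : Set (Param d))
    (θ₀ : Param d) : Prop where
  pos : ∀ θ ∈ Ω, ∀ x y, 0 < m x y θ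
  sum_eq_one : ∀ θ ∈ Ω, ∀ x, ∑ y, m x y θ = 1
  smooth : ∀ x y, ∀ θ ∈ Ω, ContDiffAt ℝ 3 (logLik m x y) θ
  compact : IsCompact Ω
  ball : ∃ ε > 0, Metric.ball θ₀ ε ⊆ Ω

/-- The assumptions on the joint laws `P_θ` with mass `r(x) p(y | x, θ)`, `θ ∈ Ω`, when the
probability mass function `r` is used as marginal: identifiability, common support,
positive definite Fisher information. -/
structure MarginalAssumptions [MeasurableSpace X] (m : X → Fin c → Param d → ℝ)
    (Ω : Set (Param d)) (r : X → ℝ) : Prop where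
  pmf : r ∈ stdSimplex ℝ X
  identifiable : ∀ θ₁ ∈ Ω, ∀ θ₂ ∈ Ω, θ₁ ≠ θ₂ →
    ∃ A : Set (X × Fin c), MeasurableSet A ∧ jointLaw m r θ₁ A ≠ jointLaw m r θ₂ A
  common_support : ∀ θ₁ ∈ Ω, ∀ θ₂ ∈ Ω, ∀ z : X × Fin c,
    jointLaw m r θ₁ {z} ≠ 0 ↔ jointLaw m r θ₂ {z} ≠ 0
  invertible : ∀ θ ∈ Ω, (fisher m r θ).PosDef

/-- The Hessian of the log-likelihood does not depend on the class label. -/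
def LabelIndependentHessian (m : X → Fin c → Param d → ℝ) (Ω : Set (Param d)) : Prop :=
  ∀ θ ∈ Ω, ∀ x y y', hessian m θ x y = hessian m θ x y'

open scoped MatrixOrder Matrix.Norms.L2Operator in
/-- `‖A^{-1/2} B A^{-1/2}‖`, in the spectral norm, for a positive definite matrix `A`. -/
def whitenedNorm (A B : Matrix (Fin d) (Fin d) ℝ) : ℝ :=
  ‖CFC.sqrt A⁻¹ * B * CFC.sqrt A⁻¹‖

/-- The boundedness and Lipschitz assumptions with constants `L₁, L₂, L₃, L₄`; here `p` is the
uniform distribution over the pool. -/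
structure RegularityAssumptions (m : X → Fin c → Param d → ℝ) (Ω : Set (Param d))
    (θ₀ : Param d) (L₁ L₂ L₃ L₄ : ℝ) : Prop where
  nonneg : 0 ≤ L₁ ∧ 0 ≤ L₂ ∧ 0 ≤ L₃ ∧ 0 ≤ L₄
  score_bound : ∀ x y,
    (score m θ₀ x y).ofLp ⬝ᵥ
      ((fisher m (uniformMarginal X) θ₀)⁻¹ *ᵥ (score m θ₀ x y).ofLp) ≤ L₁
  fisher_bound : ∀ x,
    whitenedNorm (fisher m (uniformMarginal X) θ₀) (condFisher m θ₀ x) ≤ L₂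
  fisher_lipschitz : ∃ B ∈ 𝓝 θ₀, ∀ x, ∀ θ' ∈ B, ∀ θ'' ∈ B,
    whitenedNorm (fisher m (uniformMarginal X) θ₀)
        (condFisher m θ' x - condFisher m θ'' x) ≤
      L₃ * Real.sqrt ((θ' - θ'').ofLp ⬝ᵥ
        (fisher m (uniformMarginal X) θ₀ *ᵥ (θ' - θ'').ofLp))
  fisher_relative : ∀ x, ∀ θ ∈ Ω,
    ((condFisher m θ x - condFisher m θ₀ x)
      - (-(L₄ * ‖θ - θ₀‖)) • condFisher m θ₀ x).PosSemidef ∧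
    ((L₄ * ‖θ - θ₀‖) • condFisher m θ₀ x
      - (condFisher m θ x - condFisher m θ₀ x)).PosSemidef

/-- `θ` is a maximum likelihood estimate over `Ω` for the labelled data set `D`. -/
def IsMLE (m : X → Fin c → Param d → ℝ) (Ω : Set (Param d)) {n : ℕ}
    (D : Fin n → X × Fin c) (θ : Param d) : Prop :=
  θ ∈ Ω ∧ ∀ θ' ∈ Ω, ∑ i, logLik m (D i).1 (D i).2 θ' ≤ ∑ i, logLik m (D i).1 (D i).2 θ

/-- The Fisher information ratio `tr [I_q(θ)⁻¹ I_p(θ)]`, `p` uniform over the pool. -/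
def fisherRatio (m : X → Fin c → Param d → ℝ) (q : X → ℝ) (θ : Param d) : ℝ :=
  ((fisher m q θ)⁻¹ * fisher m (uniformMarginal X) θ).trace

end FIR

end

/-! The idea is that the maximum likelihood estimator is consistent at an explicit rate, and that
the Fisher information ratio is stable under relative Loewner perturbations.

The sample space is finite, so Chebyshev and a union bound put all empirical frequencies within `t`
of their probabilities, outside an event of probability O(1/(n t²)). The rest is deterministic. The
estimator fits the frequencies at least as well as `θ₀`, so its Kullback–Leibler divergence from
`θ₀` is at most a constant times `t * ‖θ - θ₀‖`. This divergence dominates the squared distance of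
the root masses, which by identifiability, positive definite information and compactness is at least
a multiple of `‖θ - θ₀‖ ^ 2`. Cancelling one factor gives `‖θ - θ₀‖ ≤ K * t`
(`exists_norm_sub_le_of_weighted_logLik_le`).

For `t` of order 1/β the conditional informations agree up to factors 1 ± 1/β. These survive
averaging over any marginal, and inversion reverses the Loewner order, so the ratio moves by at most
(1 + 1/β)/(1 - 1/β) (`fisherRatio_le`). The good event does not involve `q`, hence the uniformity in
`q`. -/

namespace FIR

/-! ### Linear bounds around a point of a compact set -/

section Calculus

variable {E F : Type*} [NormedAddCommGroup E] [NormedSpace ℝ E]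
  [NormedAddCommGroup F] [NormedSpace ℝ F]

/-- A map that is continuous on a compact set, differentiable at `x₀` with injective derivative,
and takes the value at `x₀` only at `x₀`, is bounded below by a multiple of the distance. -/
theorem exists_norm_sub_le_mul_norm_image_sub [FiniteDimensional ℝ E] {f : E → F} {f' : E →L[ℝ] F}
    {K : Set E} {x₀ : E} (hK : IsCompact K) (hf : ContinuousOn f K) (hf' : HasFDerivAt f f' x₀)
    (hker : ∀ v, f' v = 0 → v = 0) (hne : ∀ x ∈ K, x ≠ x₀ → f x ≠ f x₀) :
    ∃ C > 0, ∀ x ∈ K, ‖x - x₀‖ ≤ C * ‖f x - f x₀‖ := by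
  obtain ⟨A, hA0, hA⟩ := LinearMap.exists_antilipschitzWith (f' : E →ₗ[ℝ] F)
    (LinearMap.ker_eq_bot'.2 hker)
  have hA0' : (0 : ℝ) < A := hA0
  have hlow : ∀ v, ‖v‖ ≤ A * ‖f' v‖ := fun v => by
    simpa using hA.le_mul_dist v 0
  have hloc : ∀ᶠ x in 𝓝 x₀, ‖x - x₀‖ ≤ 2 * A * ‖f x - f x₀‖ := by
    -- With this constant the linearization error, multiplied by `A`, is half of `‖x - x₀‖` and is
    -- absorbed on the left.
    have h := (hasFDerivAt_iff_isLittleO.1 hf').def (c := (2 * A)⁻¹) (by positivity)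
    filter_upwards [h] with x hx
    have h1 := hlow (x - x₀)
    have h2 : ‖f' (x - x₀)‖ ≤ ‖f x - f x₀‖ + (2 * (A : ℝ))⁻¹ * ‖x - x₀‖ := by
      have := norm_sub_norm_le (f' (x - x₀)) (f x - f x₀)
      rw [norm_sub_rev (f' (x - x₀))] at this
      linarith
    have h3 := mul_le_mul_of_nonneg_left h2 hA0'.le
    have h4 : (A : ℝ) * ((2 * (A : ℝ))⁻¹ * ‖x - x₀‖) = ‖x - x₀‖ / 2 := by field_simp
    rw [mul_add, h4] at h3
    linarith
  obtain ⟨ε, hε, hball⟩ := Metric.eventually_nhds_iff_ball.1 hloc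
  -- Away from `x₀` the quotient of the two distances is continuous on a compact set, hence bounded.
  have hK' : IsCompact (K \ Metric.ball x₀ ε) := hK.diff Metric.isOpen_ball
  have hpos : ∀ x ∈ K \ Metric.ball x₀ ε, 0 < ‖f x - f x₀‖ := fun x hx => by
    refine norm_pos_iff.2 (sub_ne_zero.2 (hne x hx.1 ?_))
    rintro rfl
    exact hx.2 (Metric.mem_ball_self hε)
  have hcont : ContinuousOn (fun x => ‖x - x₀‖ / ‖f x - f x₀‖) (K \ Metric.ball x₀ ε) :=
    ContinuousOn.div (by fun_prop)
      (((hf.mono Set.sdiff_subset).sub continuousOn_const).norm) fun x hx => (hpos x hx).ne'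
  obtain ⟨B, hB⟩ := hK'.bddAbove_image hcont
  refine ⟨max (2 * A) B, lt_max_of_lt_left (by positivity), fun x hx => ?_⟩
  by_cases hxε : x ∈ Metric.ball x₀ ε
  · exact (hball x hxε).trans (mul_le_mul_of_nonneg_right (le_max_left _ _) (norm_nonneg _))
  · have := hB (Set.mem_image_of_mem _ ⟨hx, hxε⟩)
    rw [div_le_iff₀ (hpos x ⟨hx, hxε⟩)] at this
    exact this.trans (mul_le_mul_of_nonneg_right (le_max_right _ _) (norm_nonneg _))

/-- A map that is continuous on a compact set and differentiable at `x₀` varies at most linearly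
from its value at `x₀`. -/
theorem exists_norm_image_sub_le_mul_norm_sub {f : E → F} {K : Set E} {x₀ : E}
    (hK : IsCompact K) (hf : ContinuousOn f K) (hf' : DifferentiableAt ℝ f x₀) :
    ∃ C > 0, ∀ x ∈ K, ‖f x - f x₀‖ ≤ C * ‖x - x₀‖ := by
  obtain ⟨A, hA0, hA⟩ := hf'.isBigO_sub.exists_pos
  obtain ⟨ε, hε, hball⟩ := Metric.eventually_nhds_iff_ball.1 hA.bound
  have hpos : ∀ x ∈ K \ Metric.ball x₀ ε, 0 < ‖x - x₀‖ := fun x hx => by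
    refine norm_pos_iff.2 (sub_ne_zero.2 ?_)
    rintro rfl
    exact hx.2 (Metric.mem_ball_self hε)
  have hcont : ContinuousOn (fun x => ‖f x - f x₀‖ / ‖x - x₀‖) (K \ Metric.ball x₀ ε) :=
    ContinuousOn.div ((hf.mono Set.sdiff_subset).sub continuousOn_const).norm
      (by fun_prop) fun x hx => (hpos x hx).ne'
  obtain ⟨B, hB⟩ := (hK.diff Metric.isOpen_ball).bddAbove_image hcont
  refine ⟨max A B, lt_max_of_lt_left hA0, fun x hx => ?_⟩
  by_cases hxε : x ∈ Metric.ball x₀ ε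
  · exact (hball x hxε).trans (mul_le_mul_of_nonneg_right (le_max_left _ _) (norm_nonneg _))
  · have := hB (Set.mem_image_of_mem _ ⟨hx, hxε⟩)
    rw [div_le_iff₀ (hpos x ⟨hx, hxε⟩)] at this
    exact this.trans (mul_le_mul_of_nonneg_right (le_max_right _ _) (norm_nonneg _))

end Calculus

/-! ### Loewner order and traces -/

section Trace

open scoped MatrixOrder Matrix.Norms.L2Operator

variable {ι : Type*} [Fintype ι] [DecidableEq ι]

theorem trace_mul_nonneg {A B : Matrix ι ι ℝ} (hA : A.PosSemidef) (hB : B.PosSemidef) :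
    0 ≤ (A * B).trace := by
  obtain ⟨C, rfl⟩ := CStarAlgebra.nonneg_iff_eq_star_mul_self.1 hA.nonneg
  rw [Matrix.mul_assoc, Matrix.trace_mul_comm]
  exact (hB.mul_mul_conjTranspose_same C).trace_nonneg

theorem posSemidef_inv_sub_inv {A B : Matrix ι ι ℝ} (hA : A.PosDef) (hB : B.PosDef)
    (hAB : (B - A).PosSemidef) : (A⁻¹ - B⁻¹).PosSemidef := by
  have hA1 := Matrix.mul_nonsing_inv A ((Matrix.isUnit_iff_isUnit_det A).1 hA.isUnit)
  have hA2 := Matrix.nonsing_inv_mul A ((Matrix.isUnit_iff_isUnit_det A).1 hA.isUnit)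
  have hB1 := Matrix.mul_nonsing_inv B ((Matrix.isUnit_iff_isUnit_det B).1 hB.isUnit)
  -- Both summands are congruences of positive semidefinite matrices.
  have key : A⁻¹ - B⁻¹ = (A⁻¹ - B⁻¹) * A * (A⁻¹ - B⁻¹) + B⁻¹ * (B - A) * B⁻¹ := by
    simp only [Matrix.sub_mul, Matrix.mul_sub, Matrix.mul_assoc, hA1, hB1, Matrix.mul_one]
    rw [← Matrix.mul_assoc A⁻¹ A, hA2, Matrix.one_mul]
    abel
  have h1 := hA.posSemidef.conjTranspose_mul_mul_same (A⁻¹ - B⁻¹)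
  have h2 := hAB.conjTranspose_mul_mul_same B⁻¹
  rw [(hA.inv.isHermitian.sub hB.inv.isHermitian).eq] at h1
  rw [hB.inv.isHermitian.eq] at h2
  rw [key]
  exact h1.add h2

/-- The trace of `A⁻¹ B` at two pairs of matrices that are close in the relative Loewner sense. -/
theorem trace_inv_mul_le {A A' B B' : Matrix ι ι ℝ} {s t : ℝ} (ht : 0 < t) (hs : 0 < s)
    (hA : A.PosDef) (hA' : A'.PosDef) (hB : B.PosSemidef)
    (hAA' : (t • A - A').PosSemidef) (hBB' : (B' - s • B).PosSemidef) :
    (A⁻¹ * B).trace ≤ t / s * (A'⁻¹ * B').trace := by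
  have h1 := trace_mul_nonneg hA'.inv.posSemidef hBB'
  have h2 := trace_mul_nonneg (posSemidef_inv_sub_inv hA' (hA.smul ht) hAA') hB
  have h3 : (t • A)⁻¹ = t⁻¹ • A⁻¹ := by
    have := Matrix.inv_smul' A (Units.mk0 t ht.ne') ((Matrix.isUnit_iff_isUnit_det A).1 hA.isUnit)
    simpa [Units.smul_def] using this
  rw [h3, Matrix.sub_mul, Matrix.trace_sub, Matrix.smul_mul, Matrix.trace_smul, smul_eq_mul] at h2
  rw [Matrix.mul_sub, Matrix.trace_sub, Matrix.mul_smul, Matrix.trace_smul, smul_eq_mul] at h1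
  have h4 : (A⁻¹ * B).trace ≤ t * (A'⁻¹ * B).trace := by
    rw [sub_nonneg, inv_mul_le_iff₀ ht] at h2
    exact h2
  have h5 : (A'⁻¹ * B).trace ≤ (A'⁻¹ * B').trace / s := by
    rw [le_div_iff₀ hs]; linarith
  calc _ ≤ t * ((A'⁻¹ * B').trace / s) := h4.trans (mul_le_mul_of_nonneg_left h5 ht.le)
    _ = _ := by ring

end Trace

/-! ### Concentration of empirical frequencies -/

section Concentration

open ProbabilityTheory

variable {Z : Type*} [Fintype Z] [MeasurableSpace Z] [MeasurableSingletonClass Z]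

/-- Chebyshev's inequality for the empirical frequency of a point. -/
theorem measureReal_le_abs_frequency_sub [DecidableEq Z] (μ : Measure Z) [IsProbabilityMeasure μ]
    {n : ℕ} (hn : 0 < n) {t : ℝ} (ht : 0 < t) (z : Z) :
    (Measure.pi fun _ : Fin n => μ).real
      {D | t ≤ |(∑ i, if D i = z then (1 : ℝ) else 0) / n - μ.real {z}|} ≤ 1 / (n * t ^ 2) := by
  set P := Measure.pi fun _ : Fin n => μ
  set f : Z → ℝ := fun w => if w = z then 1 else 0
  have hf : MemLp f 2 μ := MemLp.of_discrete
  have hn' : (0 : ℝ) < n := by exact_mod_cast hn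
  set S : (Fin n → Z) → ℝ := ∑ i, fun D => f (D i)
  have hS : MemLp S 2 P := MemLp.of_discrete
  have hmean : ∫ D, S D ∂P = n * μ.real {z} := by
    have h1 : ∀ i : Fin n, ∫ D, f (D i) ∂P = μ.real {z} := fun i => by
      have h := (measurePreserving_eval (fun _ : Fin n => μ) i).map_eq
      calc ∫ D, f (D i) ∂P = ∫ w, f w ∂μ := by
            conv_rhs => rw [← h]
            exact (integral_map (measurable_pi_apply i).aemeasurable
              (measurable_of_finite f).aestronglyMeasurable).symm
        _ = ∫ w, ({z} : Set Z).indicator 1 w ∂μ := by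
            congr 1 with w
            simp [f, Set.indicator_apply]
        _ = μ.real {z} := integral_indicator_one (measurableSet_singleton z)
    simp only [S, Finset.sum_apply]
    rw [integral_finsetSum _ fun i _ => Integrable.of_finite]
    simp [h1]
  have hvar : Var[S; P] ≤ n := by
    rw [variance_sum_pi (μ := fun _ : Fin n => μ) (X := fun _ => f) fun _ => hf]
    -- Popoviciu's inequality gives 1/4 per sample; the cruder bound 1 is all that is kept.
    have : Var[f; μ] ≤ ((1 - 0) / 2) ^ 2 := variance_le_sq_of_bounded
      (ae_of_all _ fun w => by by_cases h : w = z <;> simp [f, h]) hf.aemeasurable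
    simp only [Finset.sum_const, Finset.card_univ, Fintype.card_fin, nsmul_eq_mul]
    nlinarith
  have hcheb := meas_ge_le_variance_div_sq hS (c := n * t) (by positivity)
  have hset : {D : Fin n → Z | t ≤ |(∑ i, if D i = z then (1 : ℝ) else 0) / n - μ.real {z}|}
      = {D | n * t ≤ |S D - ∫ D, S D ∂P|} := by
    ext D
    have : (∑ i, if D i = z then (1 : ℝ) else 0) / n - μ.real {z}
        = (S D - n * μ.real {z}) / n := by
      simp only [S, f, Finset.sum_apply]; field_simp
    rw [Set.mem_ofPred_eq, Set.mem_ofPred_eq, hmean, this, abs_div, abs_of_pos hn',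
      le_div_iff₀ hn', mul_comm]
  rw [hset, measureReal_def]
  refine ENNReal.toReal_le_of_le_ofReal (by positivity) (hcheb.trans (ENNReal.ofReal_le_ofReal ?_))
  calc _ ≤ n / (n * t) ^ 2 := by gcongr
    _ = _ := by field_simp

/-- All empirical frequencies are simultaneously close to the probabilities, with high
probability. -/
theorem one_sub_le_measureReal_abs_frequency_sub_lt [DecidableEq Z] (μ : Measure Z)
    [IsProbabilityMeasure μ] {n : ℕ} (hn : 0 < n) {t : ℝ} (ht : 0 < t) :
    1 - Fintype.card Z / (n * t ^ 2) ≤ (Measure.pi fun _ : Fin n => μ).real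
      {D | ∀ z, |(∑ i, if D i = z then (1 : ℝ) else 0) / n - μ.real {z}| < t} := by
  set P := Measure.pi fun _ : Fin n => μ
  have h := measureReal_iUnion_fintype_le (μ := P) fun z : Z =>
    {D : Fin n → Z | t ≤ |(∑ i, if D i = z then (1 : ℝ) else 0) / n - μ.real {z}|}
  have h' := h.trans (Finset.sum_le_sum fun z _ => measureReal_le_abs_frequency_sub μ hn ht z)
  have hc : {D : Fin n → Z | ∀ z, |(∑ i, if D i = z then (1 : ℝ) else 0) / n - μ.real {z}| < t}
      = (⋃ z : Z, {D : Fin n → Z |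
        t ≤ |(∑ i, if D i = z then (1 : ℝ) else 0) / n - μ.real {z}|})ᶜ := by
    ext D; simp
  rw [hc, probReal_compl_eq_one_sub (Set.toFinite _).measurableSet]
  simp only [Finset.sum_const, Finset.card_univ, nsmul_eq_mul, mul_one_div] at h'
  linarith

end Concentration


/-! ### Deterministic estimates for the model -/

section Model

variable {X : Type*} {c d : ℕ} {m : X → Fin c → Param d → ℝ} {Ω : Set (Param d)}
  {θ₀ : Param d} {r : X → ℝ}

theorem ModelAssumptions.mem (h : ModelAssumptions m Ω θ₀) : θ₀ ∈ Ω := by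
  obtain ⟨ε, hε, hball⟩ := h.ball
  exact hball (Metric.mem_ball_self hε)

theorem ModelAssumptions.exp_logLik (h : ModelAssumptions m Ω θ₀) {θ : Param d} (hθ : θ ∈ Ω)
    (x : X) (y : Fin c) : Real.exp (logLik m x y θ) = m x y θ :=
  Real.exp_log (h.pos θ hθ x y)

theorem ModelAssumptions.differentiableAt (h : ModelAssumptions m Ω θ₀) {θ : Param d}
    (hθ : θ ∈ Ω) (x : X) (y : Fin c) : DifferentiableAt ℝ (logLik m x y) θ :=
  (h.smooth x y θ hθ).differentiableAt (by norm_num)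

theorem ModelAssumptions.continuousOn (h : ModelAssumptions m Ω θ₀) (x : X) (y : Fin c) :
    ContinuousOn (logLik m x y) Ω :=
  fun _ hθ => (h.differentiableAt hθ x y).continuousAt.continuousWithinAt

theorem fderiv_logLik_apply (h : ModelAssumptions m Ω θ₀) {θ : Param d} (hθ : θ ∈ Ω) (x : X)
    (y : Fin c) (v : Param d) :
    fderiv ℝ (logLik m x y) θ v = v.ofLp ⬝ᵥ (score m θ x y).ofLp := by
  rw [(h.differentiableAt hθ x y).hasGradientAt.hasFDerivAt.fderiv,
    InnerProductSpace.toDual_apply_apply, EuclideanSpace.inner_eq_star_dotProduct, star_trivial,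
    score]

/-- The square roots of the masses of the joint law. -/
noncomputable def rootMass (m : X → Fin c → Param d → ℝ) (r : X → ℝ) (θ : Param d)
    (z : X × Fin c) : ℝ :=
  √(r z.1) * Real.exp (logLik m z.1 z.2 θ / 2)

/-- The squares of the components of this derivative in a direction `v` sum to a quarter of the
Fisher quadratic form at `v`, so positive definite information makes the derivative injective. -/
theorem hasFDerivAt_rootMass (h : ModelAssumptions m Ω θ₀) {θ : Param d} (hθ : θ ∈ Ω) :
    HasFDerivAt (rootMass m r) (ContinuousLinearMap.pi fun z : X × Fin c =>
      (rootMass m r θ z / 2) • fderiv ℝ (logLik m z.1 z.2) θ) θ := by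
  refine hasFDerivAt_pi.2 fun z => ?_
  have := (((h.differentiableAt hθ z.1 z.2).hasFDerivAt.mul_const (2⁻¹ : ℝ)).exp).const_mul
    √(r z.1)
  refine (this.congr_fderiv ?_).congr_of_eventuallyEq (.of_forall fun θ' => ?_)
  · ext v
    simp [rootMass, div_eq_mul_inv]
    ring
  · simp [rootMass, div_eq_mul_inv]

variable [Fintype X]

theorem ModelAssumptions.sum_mass (h : ModelAssumptions m Ω θ₀) (hr : r ∈ stdSimplex ℝ X)
    {θ : Param d} (hθ : θ ∈ Ω) : ∑ z : X × Fin c, r z.1 * m z.1 z.2 θ = 1 := by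
  rw [Fintype.sum_prod_type]
  simp only [← Finset.mul_sum, h.sum_eq_one θ hθ, mul_one]
  exact hr.2

theorem ModelAssumptions.mass_nonneg (h : ModelAssumptions m Ω θ₀) (hr : r ∈ stdSimplex ℝ X)
    {θ : Param d} (hθ : θ ∈ Ω) (x : X) (y : Fin c) : 0 ≤ r x * m x y θ :=
  mul_nonneg (hr.1 x) (h.pos θ hθ x y).le

theorem jointLaw_singleton [MeasurableSpace X] [MeasurableSingletonClass X] (z : X × Fin c)
    (θ : Param d) : jointLaw m r θ {z} = ENNReal.ofReal (r z.1 * m z.1 z.2 θ) := by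
  classical
  rw [jointLaw, ← Fintype.sum_prod_type' (f := fun x y =>
    ENNReal.ofReal (r x * m x y θ) • Measure.dirac (x, y)), Measure.finsetSum_apply]
  simp [Set.indicator_apply]

theorem jointLaw_real_singleton [MeasurableSpace X] [MeasurableSingletonClass X]
    (h : ModelAssumptions m Ω θ₀) (hr : r ∈ stdSimplex ℝ X) {θ : Param d} (hθ : θ ∈ Ω)
    (z : X × Fin c) : (jointLaw m r θ).real {z} = r z.1 * m z.1 z.2 θ := by
  rw [measureReal_def, jointLaw_singleton, ENNReal.toReal_ofReal (h.mass_nonneg hr hθ _ _)]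

theorem isProbabilityMeasure_jointLaw [MeasurableSpace X] [MeasurableSingletonClass X]
    (h : ModelAssumptions m Ω θ₀) (hr : r ∈ stdSimplex ℝ X) {θ : Param d} (hθ : θ ∈ Ω) :
    IsProbabilityMeasure (jointLaw m r θ) := by
  constructor
  have := sum_measure_singleton (μ := jointLaw m r θ) (s := Finset.univ)
  rw [Finset.coe_univ] at this
  rw [← this]
  simp only [jointLaw_singleton]
  rw [← ENNReal.ofReal_sum_of_nonneg fun z _ => h.mass_nonneg hr hθ _ _, h.sum_mass hr hθ,
    ENNReal.ofReal_one]

theorem rootMass_sq (h : ModelAssumptions m Ω θ₀) (hr : r ∈ stdSimplex ℝ X) {θ : Param d}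
    (hθ : θ ∈ Ω) (z : X × Fin c) : rootMass m r θ z ^ 2 = r z.1 * m z.1 z.2 θ := by
  rw [rootMass, mul_pow, Real.sq_sqrt (hr.1 _), ← Real.exp_nat_mul, ← h.exp_logLik hθ]
  congr 2
  push_cast
  ring

theorem rootMass_ne [MeasurableSpace X] (h : ModelAssumptions m Ω θ₀)
    (hr : MarginalAssumptions m Ω r) {θ θ' : Param d} (hθ : θ ∈ Ω) (hθ' : θ' ∈ Ω)
    (hne : θ ≠ θ') : rootMass m r θ ≠ rootMass m r θ' := by
  intro heq
  obtain ⟨A, -, hA⟩ := hr.identifiable θ hθ θ' hθ' hne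
  refine hA ?_
  have : jointLaw m r θ = jointLaw m r θ' := by
    refine Finset.sum_congr rfl fun x _ => Finset.sum_congr rfl fun y _ => ?_
    rw [← rootMass_sq h hr.pmf hθ (x, y), ← rootMass_sq h hr.pmf hθ' (x, y), heq]
  rw [this]

theorem dotProduct_fisher_mulVec (θ v : Param d) :
    v.ofLp ⬝ᵥ (fisher m r θ *ᵥ v.ofLp) =
      ∑ x, r x * ∑ y, m x y θ * (v.ofLp ⬝ᵥ (score m θ x y).ofLp) ^ 2 := by
  simp only [fisher, condFisher, Matrix.sum_mulVec, dotProduct_sum, Matrix.smul_mulVec,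
    dotProduct_smul, Matrix.vecMulVec_mulVec, smul_eq_mul]
  refine Finset.sum_congr rfl fun x _ => congrArg _ (Finset.sum_congr rfl fun y _ => ?_)
  simp [dotProduct_comm (score m θ x y).ofLp, sq]

/-- The squared distance of the root masses is at most the Kullback–Leibler divergence. -/
theorem sum_rootMass_sub_sq_le (h : ModelAssumptions m Ω θ₀) (hr : r ∈ stdSimplex ℝ X)
    {θ : Param d} (hθ : θ ∈ Ω) :
    ∑ z, (rootMass m r θ z - rootMass m r θ₀ z) ^ 2 ≤
      ∑ z : X × Fin c, r z.1 * m z.1 z.2 θ₀ * (logLik m z.1 z.2 θ₀ - logLik m z.1 z.2 θ) := by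
  -- Expand the square and bound the cross term by `1 + u ≤ exp u`, with `u` half the log-likelihood
  -- difference. The leftover difference of masses sums to zero.
  have key : ∀ z : X × Fin c, (rootMass m r θ z - rootMass m r θ₀ z) ^ 2 ≤
      r z.1 * m z.1 z.2 θ₀ * (logLik m z.1 z.2 θ₀ - logLik m z.1 z.2 θ)
        + (r z.1 * m z.1 z.2 θ - r z.1 * m z.1 z.2 θ₀) := fun z => by
    have h0 := rootMass_sq h hr h.mem z
    have h1 := rootMass_sq h hr hθ z
    have h2 : rootMass m r θ z = rootMass m r θ₀ z *
        Real.exp ((logLik m z.1 z.2 θ - logLik m z.1 z.2 θ₀) / 2) := by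
      rw [rootMass, rootMass, mul_assoc, ← Real.exp_add]
      congr 2
      ring
    have h3 := Real.add_one_le_exp ((logLik m z.1 z.2 θ - logLik m z.1 z.2 θ₀) / 2)
    have h4 := mul_le_mul_of_nonneg_left h3 (sq_nonneg (rootMass m r θ₀ z))
    have h5 : rootMass m r θ₀ z * rootMass m r θ z = rootMass m r θ₀ z ^ 2 *
        Real.exp ((logLik m z.1 z.2 θ - logLik m z.1 z.2 θ₀) / 2) := by
      rw [h2]; ring
    rw [← h5] at h4
    rw [← h0, ← h1]
    nlinarith
  refine (Finset.sum_le_sum fun z _ => key z).trans_eq ?_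
  rw [Finset.sum_add_distrib, Finset.sum_sub_distrib, h.sum_mass hr hθ, h.sum_mass hr h.mem]
  ring

/-- The root masses, as functions of the parameter, are bounded below by a multiple of the
distance to the true parameter. -/
theorem exists_norm_sub_le_norm_rootMass_sub [MeasurableSpace X] (h : ModelAssumptions m Ω θ₀)
    (hr : MarginalAssumptions m Ω r) :
    ∃ A > 0, ∀ θ ∈ Ω, ‖θ - θ₀‖ ≤ A * ‖rootMass m r θ - rootMass m r θ₀‖ := by
  refine exists_norm_sub_le_mul_norm_image_sub h.compact ?_ (hasFDerivAt_rootMass h h.mem) ?_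
    fun θ hθ hne => rootMass_ne h hr hθ h.mem hne
  · exact fun θ hθ => (hasFDerivAt_rootMass h hθ).continuousAt.continuousWithinAt
  · intro v hv
    by_contra hne
    have hpos := (hr.invertible θ₀ h.mem).dotProduct_mulVec_pos (x := v.ofLp) (by simpa using hne)
    rw [star_trivial, dotProduct_fisher_mulVec] at hpos
    refine hpos.ne' (Finset.sum_eq_zero fun x _ => ?_)
    rw [Finset.mul_sum]
    refine Finset.sum_eq_zero fun y _ => ?_
    have hz : rootMass m r θ₀ (x, y) / 2 * fderiv ℝ (logLik m x y) θ₀ v = 0 := congrFun hv (x, y)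
    rw [fderiv_logLik_apply h h.mem, mul_eq_zero, div_eq_zero_iff, or_iff_left two_ne_zero] at hz
    rw [← mul_assoc, ← rootMass_sq h hr.pmf h.mem (x, y)]
    rcases hz with hz | hz <;> simp [hz]

/-- If the weights `w` are close to the masses of the joint law at `θ₀`, then every parameter with
a weighted log-likelihood at least as large as that of `θ₀` is close to `θ₀`. -/
theorem exists_norm_sub_le_of_weighted_logLik_le [MeasurableSpace X]
    (h : ModelAssumptions m Ω θ₀) (hr : MarginalAssumptions m Ω r) :
    ∃ K > 0, ∀ (w : X × Fin c → ℝ) (t : ℝ), (∀ z, |w z - r z.1 * m z.1 z.2 θ₀| ≤ t) →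
      ∀ θ ∈ Ω, ∑ z, w z * logLik m z.1 z.2 θ₀ ≤ ∑ z, w z * logLik m z.1 z.2 θ →
        ‖θ - θ₀‖ ≤ K * t := by
  obtain ⟨A, hA0, hA⟩ := exists_norm_sub_le_norm_rootMass_sub h hr
  -- `Ω` need not be convex, so compactness replaces the mean value inequality.
  obtain ⟨M, hM0, hM⟩ := exists_norm_image_sub_le_mul_norm_sub
    (f := fun θ (z : X × Fin c) => logLik m z.1 z.2 θ) h.compact
    (continuousOn_pi.2 fun z => h.continuousOn z.1 z.2)
    (differentiableAt_pi.2 fun z => h.differentiableAt h.mem z.1 z.2)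
  refine ⟨A ^ 2 * (Fintype.card (X × Fin c) + 1) * M, by positivity,
    fun w t hw θ hθ hle => ?_⟩
  set N : ℝ := (Fintype.card (X × Fin c) : ℝ)
  have hnorm : ‖rootMass m r θ - rootMass m r θ₀‖ ^ 2 ≤
      ∑ z, (rootMass m r θ z - rootMass m r θ₀ z) ^ 2 := by
    have hs : 0 ≤ ∑ z, (rootMass m r θ z - rootMass m r θ₀ z) ^ 2 :=
      Finset.sum_nonneg fun z _ => sq_nonneg _
    rw [← Real.le_sqrt (norm_nonneg _) hs, pi_norm_le_iff_of_nonneg (Real.sqrt_nonneg _)]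
    intro z
    refine Real.abs_le_sqrt ?_
    exact Finset.single_le_sum (f := fun z => (rootMass m r θ z - rootMass m r θ₀ z) ^ 2)
      (fun z _ => sq_nonneg _) (Finset.mem_univ z)
  rcases isEmpty_or_nonempty (X × Fin c) with hE | ⟨⟨z₀⟩⟩
  · have h1 := h.sum_mass hr.pmf h.mem
    simp at h1
  have ht : 0 ≤ t := (abs_nonneg _).trans (hw z₀)
  have hlik : ∑ z : X × Fin c,
      r z.1 * m z.1 z.2 θ₀ * (logLik m z.1 z.2 θ₀ - logLik m z.1 z.2 θ) ≤
      N * (t * (M * ‖θ - θ₀‖)) := by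
    -- Replacing the true mass by `w z` costs at most `t` times the log-likelihood difference; the
    -- sum of the `w`-terms is nonpositive by `hle`.
    have h1 : ∀ z : X × Fin c,
        r z.1 * m z.1 z.2 θ₀ * (logLik m z.1 z.2 θ₀ - logLik m z.1 z.2 θ) ≤
        t * (M * ‖θ - θ₀‖) +
          (w z * logLik m z.1 z.2 θ₀ - w z * logLik m z.1 z.2 θ) := fun z => by
      have h2 : |logLik m z.1 z.2 θ - logLik m z.1 z.2 θ₀| ≤ M * ‖θ - θ₀‖ :=
        (norm_le_pi_norm (fun z : X × Fin c => logLik m z.1 z.2 θ - logLik m z.1 z.2 θ₀) z).trans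
          (hM θ hθ)
      have h3 := mul_le_mul (hw z) h2 (abs_nonneg _) ht
      rw [← abs_mul] at h3
      have h4 := (le_abs_self _).trans h3
      linarith
    refine (Finset.sum_le_sum fun z _ => h1 z).trans ?_
    rw [Finset.sum_add_distrib, Finset.sum_sub_distrib]
    simp only [Finset.sum_const, Finset.card_univ, nsmul_eq_mul]
    linarith
  have hsq : ‖θ - θ₀‖ ^ 2 ≤ A ^ 2 * (N * (t * (M * ‖θ - θ₀‖))) := by
    calc ‖θ - θ₀‖ ^ 2 ≤ (A * ‖rootMass m r θ - rootMass m r θ₀‖) ^ 2 := by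
          gcongr; exact hA θ hθ
      _ = A ^ 2 * ‖rootMass m r θ - rootMass m r θ₀‖ ^ 2 := by ring
      _ ≤ _ := by
          gcongr
          exact hnorm.trans ((sum_rootMass_sub_sq_le h hr.pmf hθ).trans hlik)
  have hN : (0 : ℝ) ≤ N := Nat.cast_nonneg _
  -- A quadratic lower bound against a linear upper bound: cancel one factor.
  rcases (norm_nonneg (θ - θ₀)).eq_or_lt with h0 | h0
  · rw [← h0]; positivity
  · have : ‖θ - θ₀‖ * ‖θ - θ₀‖ ≤ (A ^ 2 * N * M * t) * ‖θ - θ₀‖ := by linarith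
    refine (le_of_mul_le_mul_right this h0).trans ?_
    have h5 : 0 ≤ A ^ 2 * M * t := by positivity
    linarith

theorem sum_logLik_eq_sum_frequency [DecidableEq X] {n : ℕ} (D : Fin n → X × Fin c)
    (θ : Param d) : ∑ i, logLik m (D i).1 (D i).2 θ =
      ∑ z, (∑ i, if D i = z then (1 : ℝ) else 0) * logLik m z.1 z.2 θ := by
  simp only [Finset.sum_mul]
  rw [Finset.sum_comm]
  simp

/-- With relatively close conditional Fisher information matrices, the Fisher information
ratios are close. -/
theorem fisherRatio_le {q : X → ℝ} {θ : Param d} {η : ℝ} (hη0 : 0 ≤ η) (hη : η < 1)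
    (hq : q ∈ stdSimplex ℝ X) (hq₀ : (fisher m q θ₀).PosDef) (hqθ : (fisher m q θ).PosDef)
    (hp₀ : (fisher m (uniformMarginal X) θ₀).PosDef)
    (hlow : ∀ x, (condFisher m θ x - (1 - η) • condFisher m θ₀ x).PosSemidef)
    (hupp : ∀ x, ((1 + η) • condFisher m θ₀ x - condFisher m θ x).PosSemidef) :
    fisherRatio m q θ₀ ≤ (1 + η) / (1 - η) * fisherRatio m q θ := by
  refine trace_inv_mul_le (by linarith) (by linarith) hq₀ hqθ hp₀.posSemidef ?_ ?_
  · have : (1 + η) • fisher m q θ₀ - fisher m q θ =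
        ∑ x, q x • ((1 + η) • condFisher m θ₀ x - condFisher m θ x) := by
      simp only [fisher, Finset.smul_sum, smul_sub, Finset.sum_sub_distrib, smul_comm (1 + η)]
    rw [this]
    exact Matrix.posSemidef_sum _ fun x _ => (hupp x).smul (hq.1 x)
  · have : fisher m (uniformMarginal X) θ - (1 - η) • fisher m (uniformMarginal X) θ₀ =
        ∑ x, uniformMarginal X x • (condFisher m θ x - (1 - η) • condFisher m θ₀ x) := by
      simp only [fisher, Finset.smul_sum, smul_sub, Finset.sum_sub_distrib, smul_comm (1 - η)]
    rw [this]
    exact Matrix.posSemidef_sum _ fun x _ => (hlow x).smul (by unfold uniformMarginal; positivity)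

end Model

end FIR

/-! ### The main theorem -/

theorem mainTheorem4 {X : Type*} [Fintype X] [Nonempty X] [MeasurableSpace X]
    [MeasurableSingletonClass X] {c d : ℕ} (hc : 1 < c)
    (m : X → Fin c → FIR.Param d → ℝ) (Ω : Set (FIR.Param d)) (θ₀ : FIR.Param d)
    (r : X → ℝ)
    (hmodel : FIR.ModelAssumptions m Ω θ₀)
    (htrain : FIR.MarginalAssumptions m Ω r)
    (htest : FIR.MarginalAssumptions m Ω (FIR.uniformMarginal X))
    (hHess : FIR.LabelIndependentHessian m Ω)
    (L₁ L₂ L₃ L₄ : ℝ) (hreg : FIR.RegularityAssumptions m Ω θ₀ L₁ L₂ L₃ L₄) :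
    ∃ C : ℝ, 0 < C ∧ ∀ β : ℝ, 10 ≤ β → ∀ δ : ℝ, 0 < δ → δ < 1 →
      ∀ n : ℕ, C * β ^ 2 / δ ≤ (n : ℝ) →
      ∀ θhat : (Fin n → X × Fin c) → FIR.Param d, (∀ D, FIR.IsMLE m Ω D (θhat D)) →
        1 - δ ≤ (Measure.pi fun _ : Fin n => FIR.jointLaw m r θ₀).real
          {D | ∀ q ∈ stdSimplex ℝ X, (∀ θ ∈ Ω, (FIR.fisher m q θ).PosDef) →
            FIR.fisherRatio m q θ₀ ≤
              (β + 1) / (β - 1) * FIR.fisherRatio m q (θhat D)} := by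
  classical
  obtain ⟨K, hK0, hK⟩ := FIR.exists_norm_sub_le_of_weighted_logLik_le hmodel htrain
  have hL : 0 ≤ L₄ := hreg.nonneg.2.2.2
  have : IsProbabilityMeasure (FIR.jointLaw m r θ₀) :=
    FIR.isProbabilityMeasure_jointLaw hmodel htrain.pmf hmodel.mem
  have : Nonempty (Fin c) := ⟨⟨0, by omega⟩⟩
  have hcard : (0 : ℝ) < Fintype.card (X × Fin c) := by exact_mod_cast Fintype.card_pos
  refine ⟨Fintype.card (X × Fin c) * (L₄ * K + 1) ^ 2, by positivity,
    fun β hβ δ hδ _ n hn θhat hθhat => ?_⟩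
  have hn0 : (0 : ℝ) < n := lt_of_lt_of_le (by positivity) hn
  -- Chosen so that `L₄ * K * t ≤ 1 / β`; the `+ 1` covers `L₄ = 0`. The constant `C` is then what
  -- makes the Chebyshev failure probability at most `δ`.
  set t : ℝ := 1 / (β * (L₄ * K + 1)) with ht
  have ht0 : 0 < t := by positivity
  have hprob : Fintype.card (X × Fin c) / (n * t ^ 2) ≤ δ := by
    rw [div_le_iff₀ hδ] at hn
    rw [div_le_iff₀ (by positivity), ht, div_pow, one_pow, mul_pow, mul_one_div, mul_div_assoc',
      le_div_iff₀ (by positivity)]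
    linarith
  refine (sub_le_sub_left hprob 1).trans
    ((FIR.one_sub_le_measureReal_abs_frequency_sub_lt (FIR.jointLaw m r θ₀)
      (by exact_mod_cast hn0) ht0).trans (measureReal_mono fun D hD q hq hqpos => ?_))
  obtain ⟨hmem, hmax⟩ := hθhat D
  have hdist : ‖θhat D - θ₀‖ ≤ K * t := by
    refine hK (fun z => (∑ i, if D i = z then (1 : ℝ) else 0) / n) t (fun z => ?_) _ hmem ?_
    · rw [← FIR.jointLaw_real_singleton hmodel htrain.pmf hmodel.mem z]
      exact (hD z).le
    · have h := hmax θ₀ hmodel.mem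
      rw [FIR.sum_logLik_eq_sum_frequency, FIR.sum_logLik_eq_sum_frequency] at h
      simp only [div_mul_eq_mul_div, ← Finset.sum_div]
      exact div_le_div_of_nonneg_right h hn0.le
  have hη : L₄ * ‖θhat D - θ₀‖ ≤ 1 / β := by
    refine (mul_le_mul_of_nonneg_left hdist hL).trans ?_
    rw [ht, ← mul_assoc, mul_one_div, div_le_div_iff₀ (by positivity) (by positivity)]
    nlinarith [mul_nonneg hL hK0.le]
  have hβ0 : 0 < β := by linarith
  have hη1 : L₄ * ‖θhat D - θ₀‖ < 1 :=
    hη.trans_lt (by rw [div_lt_one hβ0]; linarith)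
  have hη0 : 0 ≤ L₄ * ‖θhat D - θ₀‖ := by positivity
  refine (FIR.fisherRatio_le hη0 hη1 hq (hqpos _ hmodel.mem) (hqpos _ hmem)
    (htest.invertible _ hmodel.mem) (fun x => ?_) fun x => ?_).trans ?_
  · convert (hreg.fisher_relative x _ hmem).1 using 1
    module
  · convert (hreg.fisher_relative x _ hmem).2 using 1
    module
  -- (1 + η)/(1 - η) increases in η and equals (β + 1)/(β - 1) at η = 1/β.
  · refine mul_le_mul_of_nonneg_right ?_ (FIR.trace_mul_nonneg (hqpos _ hmem).inv.posSemidef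
      (htest.invertible _ hmem).posSemidef)
    rw [le_div_iff₀ hβ0] at hη
    rw [div_le_div_iff₀ (by linarith) (by linarith)]
    linarith
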